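/- Let $\mathcal S,\mathcal U$ be Borel spaces (Borel subsets of complete separable metric spaces, with their Borel $\sigma$-algebras), let $\mathbb K\subseteq\mathcal S\times\mathcal U$ be a measurable set such that every section $\mathcal U(s)=\{u:(s,u)\in\mathbb K\}$ is nonempty, let $Q$ be a stochastic kernel on $\mathcal S$ given $\mathbb K$, let $r:\mathbb K\to\mathbb R$ be measurable, and let $\alpha\in[0,1)$. A randomized policy $\pi=(\pi_t)_{t\ge 0}\in\Pi$ is a sequence of stochastic kernels $\pi_t$ on $\mathcal U$ given $\mathbb K^t\times\mathcal S$ with $\pi_t(\mathcal U(s_t)\mid h_t)=1$ for every $h_t=(s_0,u_0,\dots,s_{t-1},u_{t-1},s_t)$. Let $$V(\pi,s)=\mathbb E^\pi_s\Big[\sum_{t\ge 0}\alpha^t r(s_t,u_t)\Big],\qquad V^*(s)=\sup_{\pi\in\Pi}V(\pi,s),$$ where the expectation is taken under the law of the process with $s_0=s$, $u_t\sim\pi_t(\cdot\mid h_t)$ and $s_{t+1}\sim Q(\cdot\mid s_t,u_t)$. The measurized model has the probability measures $\nu$ on $\mathcal S$ as its states; its actions, all of them feasible from every $\nu$, are the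 stochastic kernels $\varphi$ on $\mathcal U$ given $\mathcal S$ with $\varphi(\mathcal U(s)\mid s)=1$ for all $s$. Its transition is deterministic, from $\nu$ to $F(\nu,\varphi)(\cdot)=\int_{\mathcal S}\int_{\mathcal U}Q(\cdot\mid s,u)\,\varphi(du\mid s)\,\nu(ds)$, and its reward is $\overline r(\nu,\varphi)=\int_{\mathcal S}\int_{\mathcal U}r(s,u)\,\varphi(du\mid s)\,\nu(ds)$. The pairs $(\nu,\varphi)$ carry the $\sigma$-algebra generated by the joint laws $\varphi(du\mid s)\,\nu(ds)$, that is, the coarsest one that makes $(\nu,\varphi)\mapsto\varphi(du\mid s)\,\nu(ds)$ measurable. Let $\overline V^*(\nu)$ be the supremum, over all randomized history-dependent policies of the measurized model, of the expected value of $\sum_{t\ge 0}\alpha^t\,\overline r(\nu_t,\varphi_t)$ started from $\nu_0=\nu$. Assume that 1. $r$ is upper semicontinuous and bounded (above and below), and $\{u\in\mathcal U(s):r(s,u)\ge c\}$ is compact for all $s\in\mathcal S$ and $c\in\mathbb R$; 2. $Q$ is strongly continuous: $(s,u)\mapsto\int g(s')\,Q(ds'\mid s,u)$ is continuous on $\mathbb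 K$ for every bounded measurable $g:\mathcal S\to\mathbb R$; 3. there is a policy whose expected discounted reward is finite from every initial state; 4. $\{(s,u)\in\mathbb K:s\in\mathcal C\}$ is compact for every compact $\mathcal C\subseteq\mathcal S$. Then for every probability measure $\nu$ on $\mathcal S$ and every sequence $s^1,s^2,\dots$ of independent random states with law $\nu$, almost surely $$\lim_{N\to\infty}\frac1N\sum_{n=1}^N V^*(s^n)=\overline V^*(\nu).$$ -/

import Mathlib

open MeasureTheory ProbabilityTheory

noncomputable section

/-- A discrete-time control model, presented through its set `Z` of feasible state-action pairs.
`state z` is the state coordinate of the pair `z` (so that the pairs feasible from the state `x`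
are the `z` with `state z = x`), `trans z` is the law of the next state when the pair `z` is used,
and `reward z` is the one-stage reward. Both the original decision model and its measurized
counterpart are of this form. -/
structure ControlModel (X Z : Type*) [MeasurableSpace X] [MeasurableSpace Z] where
  state : Z → X
  measurable_state : Measurable state
  trans : Kernel Z X
  isMarkov_trans : IsMarkovKernel trans
  reward : Z → ℝ
  measurable_reward : Measurable reward

namespace ControlModel

variable {X Z : Type*} [MeasurableSpace X] [MeasurableSpace Z]

/-- A randomized history-dependent policy. At time `t`, given the admissible history
`(z₀, …, z_{t-1}, x_t)` of earlier state-action pairs and the current state, it draws the current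
state-action pair, whose state coordinate is the current state `x_t` (so that only the action is
being chosen, among those feasible from `x_t`). -/
structure Policy (M : ControlModel X Z) where
  kernel : ∀ t : ℕ, Kernel ((Fin t → Z) × X) Z
  isMarkov : ∀ t, IsMarkovKernel (kernel t)
  feasible : ∀ t h x, ∀ᵐ z ∂(kernel t (h, x)), M.state z = x

variable {M : ControlModel X Z}

/-- The law of the pair at time `t + 1` given the pairs at times `0, …, t`: draw the next state
from the transition law at the last pair, then draw the pair from the policy. -/
def Policy.step (π : M.Policy) (t : ℕ) : Kernel ((i : Finset.Iic t) → Z) Z :=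
  π.kernel (t + 1) ∘ₖ
    (Kernel.deterministic
        (fun (h : (i : Finset.Iic t) → Z) (i : Fin (t + 1)) =>
          h ⟨i, Finset.mem_Iic.2 (Nat.lt_succ_iff.1 i.2)⟩)
        (by fun_prop)
      ×ₖ M.trans.comap (fun h : (i : Finset.Iic t) → Z => h ⟨t, Finset.mem_Iic.2 le_rfl⟩)
        (by fun_prop))

instance (π : M.Policy) (t : ℕ) : IsMarkovKernel (π.step t) := by
  have := π.isMarkov (t + 1)
  have := M.isMarkov_trans
  unfold Policy.step
  infer_instance

/-- The law of the pair at time `0` given the initial state. -/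
def Policy.init (π : M.Policy) : Kernel X Z :=
  (π.kernel 0).comap (fun x => (Fin.elim0, x)) (by fun_prop)

/-- The Ionescu-Tulcea law of the whole sequence of state-action pairs when the initial state has
law `μ` and the policy `π` is used. -/
def Policy.law (π : M.Policy) (μ : Measure X) : Measure (ℕ → Z) :=
  Kernel.trajMeasure (X := fun _ => Z) (π.init ∘ₘ μ) π.step

/-- The discounted return of a sequence of state-action pairs. -/
def discountedReturn (M : ControlModel X Z) (α : ℝ) (ω : ℕ → Z) : ℝ :=
  ∑' t : ℕ, α ^ t * M.reward (ω t)

/-- The expected discounted reward of the policy `π` from the initial state `x`. -/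
def Policy.value (π : M.Policy) (α : ℝ) (x : X) : ℝ :=
  ∫ ω, M.discountedReturn α ω ∂(π.law (Measure.dirac x))

/-- The optimal value over all randomized history-dependent policies. -/
def optimalValue (M : ControlModel X Z) (α : ℝ) (x : X) : ℝ :=
  ⨆ π : M.Policy, π.value α x

end ControlModel

/-- A Markov decision model with states `S` and actions `U`: a measurable set `K` of feasible
state-action pairs with nonempty sections `U(s)`, a transition law on `S` given `K`, and a
measurable reward on `K`. -/
structure MarkovDecisionModel (S U : Type*) [MeasurableSpace S] [MeasurableSpace U] where
  K : Set (S × U)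
  measurableSet_K : MeasurableSet K
  nonempty_K : ∀ s, ∃ u, (s, u) ∈ K
  Q : Kernel K S
  isMarkov_Q : IsMarkovKernel Q
  r : K → ℝ
  measurable_r : Measurable r

namespace MarkovDecisionModel

variable {S U : Type*} [MeasurableSpace S] [MeasurableSpace U]

/-- The set `U(s)` of feasible actions at the state `s`. -/
def actions (M : MarkovDecisionModel S U) (s : S) : Set U := {u | (s, u) ∈ M.K}

/-- The model seen through its feasible state-action pairs. -/
def toControlModel (M : MarkovDecisionModel S U) : ControlModel S M.K where
  state k := k.1.1
  measurable_state := by fun_prop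
  trans := M.Q
  isMarkov_trans := M.isMarkov_Q
  reward := M.r
  measurable_reward := M.measurable_r

/-- If `κ a` is a law on actions concentrated on `U(σ a)`, then `M.pairKernel σ κ a` is the law of
the feasible pair `(σ a, u)` with `u` drawn from `κ a`. -/
def pairKernel (M : MarkovDecisionModel S U) {A : Type*} [MeasurableSpace A] (σ : A → S)
    (hσ : Measurable σ) (κ : Kernel A U) : Kernel A M.K :=
  (Kernel.deterministic σ hσ ×ₖ κ).comapRight (MeasurableEmbedding.subtype_coe M.measurableSet_K)

lemma pairKernel_apply (M : MarkovDecisionModel S U) {A : Type*} [MeasurableSpace A] (σ : A → S)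
    (hσ : Measurable σ) (κ : Kernel A U) [IsMarkovKernel κ] (a : A) {B : Set M.K}
    (hB : MeasurableSet B) :
    M.pairKernel σ hσ κ a B = κ a {u | ∃ h : (σ a, u) ∈ M.K, (⟨(σ a, u), h⟩ : M.K) ∈ B} := by
  have hB' : MeasurableSet ((fun k : M.K => (k : S × U)) '' B) :=
    (MeasurableEmbedding.subtype_coe M.measurableSet_K).measurableSet_image' hB
  rw [pairKernel, Kernel.comapRight_apply' _ _ _ hB, Kernel.prod_apply, Kernel.deterministic_apply,
    Measure.prod_apply hB', lintegral_dirac' _ (measurable_measure_prodMk_left hB')]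
  congr 1
  ext u
  simp

lemma map_pairKernel (M : MarkovDecisionModel S U) {A : Type*} [MeasurableSpace A] (σ : A → S)
    (hσ : Measurable σ) (κ : Kernel A U) [IsMarkovKernel κ] (hκ : ∀ a, κ a (M.actions (σ a)) = 1) :
    (M.pairKernel σ hσ κ).map (fun k => k.1.1) = Kernel.deterministic σ hσ := by
  have hf : Measurable fun k : M.K => k.1.1 := by fun_prop
  ext a B hB
  rw [Kernel.map_apply' _ hf _ hB, pairKernel_apply _ _ _ _ _ (hf hB),
    Kernel.deterministic_apply' hσ _ hB]
  by_cases h : σ a ∈ B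
  · rw [Set.indicator_of_mem h, ← hκ a]
    congr 1
    ext u
    simp [actions, h]
  · simp [h]

lemma isMarkovKernel_pairKernel (M : MarkovDecisionModel S U) {A : Type*} [MeasurableSpace A]
    (σ : A → S) (hσ : Measurable σ) (κ : Kernel A U) [IsMarkovKernel κ]
    (hκ : ∀ a, κ a (M.actions (σ a)) = 1) : IsMarkovKernel (M.pairKernel σ hσ κ) := by
  refine ⟨fun a => ⟨?_⟩⟩
  rw [pairKernel_apply _ _ _ _ _ MeasurableSet.univ, ← hκ a]
  congr 1
  ext u
  simp [actions]

/-- A randomized control policy: stochastic kernels on the actions given the admissible histories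
`(s₀, u₀, …, s_{t-1}, u_{t-1}, s_t)`, concentrated on the actions feasible at the current state. -/
structure Policy (M : MarkovDecisionModel S U) where
  kernel : ∀ t : ℕ, Kernel ((Fin t → M.K) × S) U
  isMarkov : ∀ t, IsMarkovKernel (kernel t)
  feasible : ∀ t h s, kernel t (h, s) (M.actions s) = 1

/-- A randomized control policy, read as the choice of the current state-action pair. -/
def Policy.toControlPolicy [MeasurableSingletonClass S] {M : MarkovDecisionModel S U} (π : M.Policy) :
    M.toControlModel.Policy where
  kernel t := M.pairKernel Prod.snd measurable_snd (π.kernel t)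
  isMarkov t :=
    have := π.isMarkov t
    M.isMarkovKernel_pairKernel _ _ _ fun a => π.feasible t a.1 a.2
  feasible t h s := by
    have := π.isMarkov t
    have hm : MeasurableSet {k : M.K | k.1.1 = s}ᶜ :=
      ((measurableSet_singleton s).preimage M.toControlModel.measurable_state).compl
    rw [ae_iff]
    refine (M.pairKernel_apply Prod.snd measurable_snd (π.kernel t) (h, s) hm).trans ?_
    simp

/-- The value `V(π, s)`: the expected discounted reward of the policy `π` from the state `s`. -/
def Policy.value [MeasurableSingletonClass S] {M : MarkovDecisionModel S U} (π : M.Policy) (α : ℝ) (s : S) : ℝ :=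
  π.toControlPolicy.value α s

/-- The optimal value function `V*` of the decision model. -/
def optimalValue [MeasurableSingletonClass S] (M : MarkovDecisionModel S U) (α : ℝ) (s : S) : ℝ :=
  ⨆ π : M.Policy, π.value α s

/-- The set `Φ` of Markov decision rules: stochastic kernels `φ` on the actions given the states
with `φ(U(s) | s) = 1` for every `s`. -/
structure DecisionRule (M : MarkovDecisionModel S U) where
  kernel : Kernel S U
  isMarkov : IsMarkovKernel kernel
  feasible : ∀ s, kernel s (M.actions s) = 1

/-- A feasible state-action pair `(ν, φ)` of the measurized model: a law `ν` on the states together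
with a decision rule `φ`. Every decision rule is feasible from every `ν`. -/
structure LiftedPair (M : MarkovDecisionModel S U) where
  dist : ProbabilityMeasure S
  rule : M.DecisionRule

/-- The joint law `γ(ds, du) = φ(du | s) ν(ds)` of a feasible pair of the original model when the
state is drawn from `ν` and the action from `φ`. -/
def LiftedPair.joint {M : MarkovDecisionModel S U} (p : M.LiftedPair) : ProbabilityMeasure M.K :=
  ⟨M.pairKernel id measurable_id p.rule.kernel ∘ₘ (p.dist : Measure S), by
    have := p.rule.isMarkov
    have := M.isMarkovKernel_pairKernel id measurable_id p.rule.kernel p.rule.feasible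
    infer_instance⟩

/-- Pairs `(ν, φ)` are measured through the joint laws that they determine. -/
instance (M : MarkovDecisionModel S U) : MeasurableSpace M.LiftedPair :=
  MeasurableSpace.comap LiftedPair.joint inferInstance

lemma LiftedPair.measurable_joint {M : MarkovDecisionModel S U} :
    Measurable (LiftedPair.joint : M.LiftedPair → ProbabilityMeasure M.K) :=
  comap_measurable _

lemma LiftedPair.map_joint {M : MarkovDecisionModel S U} (p : M.LiftedPair) :
    (p.joint : Measure M.K).map (fun k => k.1.1) = p.dist := by
  have := p.rule.isMarkov
  have hf : Measurable fun k : M.K => k.1.1 := by fun_prop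
  change (M.pairKernel id measurable_id p.rule.kernel ∘ₘ (p.dist : Measure S)).map _ = _
  rw [Measure.map_comp _ _ hf, M.map_pairKernel id measurable_id p.rule.kernel p.rule.feasible, Measure.deterministic_comp_eq_map,
    Measure.map_id]

/-- The deterministic transition `F(ν, φ)(B) = ∫∫ Q(B | s, u) φ(du | s) ν(ds)`. -/
def LiftedPair.next {M : MarkovDecisionModel S U} (p : M.LiftedPair) : ProbabilityMeasure S :=
  ⟨M.Q ∘ₘ (p.joint : Measure M.K), by
    have := M.isMarkov_Q
    infer_instance⟩

/-- The lifted reward `∫∫ r(s, u) φ(du | s) ν(ds)`, the integral of `r` against the joint law. -/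
def LiftedPair.reward {M : MarkovDecisionModel S U} (p : M.LiftedPair) : ℝ :=
  ∫ k, M.r k ∂(p.joint : Measure M.K)

lemma LiftedPair.measurable_dist {M : MarkovDecisionModel S U} :
    Measurable (LiftedPair.dist : M.LiftedPair → ProbabilityMeasure S) := by
  refine Measurable.subtype_mk (f := fun p : M.LiftedPair => (p.dist : Measure S)) ?_
  simp_rw [← LiftedPair.map_joint]
  exact (Measure.measurable_map _ (by fun_prop)).comp
    (measurable_subtype_coe.comp LiftedPair.measurable_joint)

lemma LiftedPair.measurable_next {M : MarkovDecisionModel S U} :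
    Measurable (LiftedPair.next : M.LiftedPair → ProbabilityMeasure S) :=
  Measurable.subtype_mk ((Measure.measurable_bind' M.Q.measurable).comp
    (measurable_subtype_coe.comp LiftedPair.measurable_joint))

lemma LiftedPair.measurable_reward {M : MarkovDecisionModel S U} :
    Measurable (LiftedPair.reward : M.LiftedPair → ℝ) := by
  let κ : Kernel M.LiftedPair M.K := ⟨fun p => (p.joint : Measure M.K),
    measurable_subtype_coe.comp LiftedPair.measurable_joint⟩
  exact (M.measurable_r.stronglyMeasurable.integral_kernel (κ := κ)).measurable

/-- The measurized counterpart of the model: the states are the laws `ν` on `S`, the actions are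
the decision rules, all of them feasible from every `ν`, the next state is `F(ν, φ)`, with
certainty, and the reward is the expected reward. -/
def measurized (M : MarkovDecisionModel S U) :
    ControlModel (ProbabilityMeasure S) M.LiftedPair where
  state := LiftedPair.dist
  measurable_state := LiftedPair.measurable_dist
  trans := Kernel.deterministic LiftedPair.next LiftedPair.measurable_next
  isMarkov_trans := inferInstance
  reward := LiftedPair.reward
  measurable_reward := LiftedPair.measurable_reward

/-- The optimal value function of the measurized counterpart. -/
def measurizedOptimalValue (M : MarkovDecisionModel S U) (α : ℝ) (ν : ProbabilityMeasure S) : ℝ :=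
  M.measurized.optimalValue α ν

section Assumptions

variable [TopologicalSpace S] [TopologicalSpace U]

/-- The reward is upper semicontinuous, bounded above, and sup-compact on `K`. -/
structure RewardRegular (M : MarkovDecisionModel S U) : Prop where
  upperSemicontinuous : UpperSemicontinuous M.r
  bddAbove : BddAbove (Set.range M.r)
  supCompact : ∀ (s : S) (c : ℝ), IsCompact {u : U | ∃ h : (s, u) ∈ M.K, c ≤ M.r ⟨(s, u), h⟩}

/-- The transition law is strongly continuous: it maps bounded measurable functions to continuous
functions on `K`. -/
def StronglyContinuous (M : MarkovDecisionModel S U) : Prop :=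
  ∀ g : S → ℝ, Measurable g → (∃ C, ∀ s, |g s| ≤ C) → Continuous fun k : M.K => ∫ s, g s ∂(M.Q k)

/-- Some policy has a finite expected discounted reward from every initial state. -/
def HasFinitePolicy [MeasurableSingletonClass S] (M : MarkovDecisionModel S U) (α : ℝ) : Prop :=
  ∃ π : M.Policy, ∀ s, Integrable (M.toControlModel.discountedReturn α)
    (π.toControlPolicy.law (Measure.dirac s))

/-- The feasible pairs over a compact set of states form a compact set. -/
def CompactOverCompact (M : MarkovDecisionModel S U) : Prop :=
  ∀ C : Set S, IsCompact C → IsCompact {k : S × U | k ∈ M.K ∧ k.1 ∈ C}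

end Assumptions

end MarkovDecisionModel

end

/-!
Let `v` be a bounded measurable solution of the optimality equation of the original model. A pair
`(ν, φ)` of the measurized model only enters through its joint law `γ`, and everything in the
optimality equation is linear in `γ`, so `ν ↦ ∫ v dν` solves the optimality equation of the
measurized model. Since a bounded solution whose maximum is attained by a measurable decision rule
is the optimal value, `V* = v` and `V̄*(ν) = ∫ v dν`, and the strong law of large numbers applied
to `v (s¹), v (s²), …` gives the result.

The solution `v` is the fixed point of the optimality operator, a contraction for the uniform
distance. Upper semicontinuity and compactness provide measurable maximizers, so the operator
preserves measurability.
-/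

section BoundedIntegrals

variable {A B : Type*} [MeasurableSpace A] [MeasurableSpace B] {μ : Measure A} {C α : ℝ}

lemma integrable_of_abs_le [IsFiniteMeasure μ] {f : A → ℝ} (hf : Measurable f)
    (hC : ∀ a, |f a| ≤ C) : Integrable f μ :=
  .of_bound hf.aestronglyMeasurable C (.of_forall hC)

lemma abs_integral_le_of_abs_le [IsProbabilityMeasure μ] {f : A → ℝ} (hC : ∀ a, |f a| ≤ C) :
    |∫ a, f a ∂μ| ≤ C := by
  simpa using norm_integral_le_of_norm_le_const (μ := μ) (f := f) (.of_forall hC)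

lemma integral_comp_measure {E : Type*} [NormedAddCommGroup E] [NormedSpace ℝ E] {κ : Kernel A B}
    {f : B → E} (hf : Integrable f (κ ∘ₘ μ)) :
    ∫ b, f b ∂(κ ∘ₘ μ) = ∫ a, ∫ b, f b ∂(κ a) ∂μ := by
  have h : κ ∘ₘ μ = (κ ∘ₖ Kernel.const Unit μ) () := by
    rw [Kernel.comp_apply, Kernel.const_apply]
  rw [h] at hf ⊢
  rw [Kernel.integral_comp hf, Kernel.const_apply]

lemma measurable_integral_probabilityMeasure {f : A → ℝ} (hf : Measurable f) :
    Measurable fun ν : ProbabilityMeasure A => ∫ a, f a ∂(ν : Measure A) :=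
  (hf.stronglyMeasurable.integral_kernel (κ := ⟨_, measurable_subtype_coe⟩)).measurable

lemma measurableSingletonClass_probabilityMeasure {S : Type*} [MeasurableSpace S]
    [MeasurableSpace.CountablyGenerated S] :
    MeasurableSingletonClass (ProbabilityMeasure S) := by
  obtain ⟨b, hb, hgen⟩ := MeasurableSpace.CountablyGenerated.isCountablyGenerated (α := S)
  have hgen' : ‹MeasurableSpace S› = MeasurableSpace.generateFrom (generateSetAlgebra b) :=
    hgen.trans generateFrom_generateSetAlgebra_eq.symm
  refine ⟨fun ν => ?_⟩
  have hsingleton : {ν} = ⋂ B ∈ generateSetAlgebra b,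
      {μ : ProbabilityMeasure S | (μ : Measure S) B = (ν : Measure S) B} := by
    ext μ
    simp only [Set.mem_singleton_iff, Set.mem_iInter, Set.mem_ofPred_eq]
    exact ⟨fun h B _ => h ▸ rfl, fun h => Subtype.ext <|
      ext_of_generate_finite (μ := (μ : Measure S)) (ν := (ν : Measure S)) _ hgen'
        (fun s hs t ht _ => isSetAlgebra_generateSetAlgebra.inter_mem hs ht) h (by simp)⟩
  rw [hsingleton]
  refine .biInter (countable_generateSetAlgebra hb) fun B hB => ?_
  have hBm : MeasurableSet B := hgen' ▸ MeasurableSpace.measurableSet_generateFrom hB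
  exact (Measure.measurable_coe hBm).comp measurable_subtype_coe (measurableSet_singleton _)

lemma hasSum_pow_mul_integral [IsFiniteMeasure μ] {f : ℕ → A → ℝ} (hα : |α| < 1)
    (hf : ∀ t, Measurable (f t)) (hC : ∀ t a, |f t a| ≤ C) :
    HasSum (fun t => α ^ t * ∫ a, f t a ∂μ) (∫ a, ∑' t, α ^ t * f t a ∂μ) := by
  have hsum : Summable fun t : ℕ => |α| ^ t * C :=
    (summable_geometric_of_lt_one (abs_nonneg α) hα).mul_right C
  have hbound : ∀ t a, ‖α ^ t * f t a‖ ≤ |α| ^ t * C := fun t a => by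
    rw [norm_mul, norm_pow, Real.norm_eq_abs, Real.norm_eq_abs]
    exact mul_le_mul_of_nonneg_left (hC t a) (by positivity)
  simp only [← integral_const_mul]
  exact hasSum_integral_of_dominated_convergence (fun t _ => |α| ^ t * C)
    (fun t => ((hf t).const_mul _).aestronglyMeasurable) (fun t => .of_forall (hbound t))
    (.of_forall fun _ => hsum) (integrable_const _)
    (.of_forall fun a => (hsum.of_norm_bounded (hbound · a)).hasSum)

lemma hasSum_pow_mul_discounted_sub {a : ℕ → ℝ} (hα : |α| < 1) (hC : ∀ t, |a t| ≤ C) :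
    HasSum (fun t => α ^ t * (α * a (t + 1) - a t)) (-a 0) := by
  have hsum : Summable fun t => α ^ t * a t := by
    refine ((summable_geometric_of_lt_one (abs_nonneg α) hα).mul_right C).of_norm_bounded
      fun t => ?_
    rw [norm_mul, norm_pow, Real.norm_eq_abs, Real.norm_eq_abs]
    exact mul_le_mul_of_nonneg_left (hC t) (by positivity)
  simpa [mul_sub, pow_succ, mul_assoc] using
    ((hasSum_nat_add_iff' 1).2 hsum.hasSum).sub hsum.hasSum

end BoundedIntegrals

section Suprema

lemma abs_ciSup_sub_ciSup_le {ι : Type*} [Nonempty ι] {f g : ι → ℝ} {ε : ℝ}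
    (hf : BddAbove (Set.range f)) (hg : BddAbove (Set.range g)) (hε : ∀ i, |f i - g i| ≤ ε) :
    |(⨆ i, f i) - ⨆ i, g i| ≤ ε := by
  rw [abs_sub_le_iff, sub_le_iff_le_add, sub_le_iff_le_add]
  constructor <;> refine ciSup_le fun i => ?_
  · linarith [le_ciSup hg i, (abs_le.1 (hε i)).2]
  · linarith [le_ciSup hf i, (abs_le.1 (hε i)).1]

end Suprema

section FixedPoint

open Filter UniformFun
open scoped UniformConvergence

variable {S : Type*} [MeasurableSpace S]

lemma isComplete_measurable_abs_le (D : ℝ) :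
    IsComplete {v : S →ᵤ ℝ | Measurable (toFun v) ∧ ∀ s, |toFun v s| ≤ D} := by
  refine IsClosed.isComplete (IsSeqClosed.isClosed fun x v hx hv => ?_)
  have hlim : ∀ s, Tendsto (fun n => toFun (x n) s) atTop (nhds (toFun v s)) :=
    (UniformFun.tendsto_iff_tendstoUniformly.1 hv).tendsto_at
  exact ⟨measurable_of_tendsto_metrizable (fun n => (hx n).1) (tendsto_pi_nhds.2 hlim),
    fun s => le_of_tendsto (hlim s).abs (.of_forall fun n => (hx n).2 s)⟩

lemma exists_measurable_fixedPoint {T : (S → ℝ) → S → ℝ} {α D : ℝ} (hα0 : 0 ≤ α) (hα1 : α < 1)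
    (hD : 0 ≤ D)
    (hT : ∀ v, Measurable v → (∀ s, |v s| ≤ D) → Measurable (T v) ∧ ∀ s, |T v s| ≤ D)
    (hdist : ∀ v w ε, Measurable v → (∀ s, |v s| ≤ D) → Measurable w → (∀ s, |w s| ≤ D) →
      (∀ s, |v s - w s| ≤ ε) → ∀ s, |T v s - T w s| ≤ α * ε) :
    ∃ v, Measurable v ∧ (∀ s, |v s| ≤ D) ∧ T v = v := by
  let W := {v : S →ᵤ ℝ | Measurable (toFun v) ∧ ∀ s, |toFun v s| ≤ D}
  let T' : (S →ᵤ ℝ) → S →ᵤ ℝ := fun v => ofFun (T (toFun v))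
  have hmaps : Set.MapsTo T' W W := fun v hv => hT _ hv.1 hv.2
  have hfin : ∀ v ∈ W, ∀ w ∈ W, edist v w ≠ ⊤ := fun v hv w hw => by
    refine ne_top_of_le_ne_top (ENNReal.ofReal_ne_top (r := D + D))
      (UniformFun.edist_le.2 fun s => ?_)
    rw [edist_dist]
    exact ENNReal.ofReal_le_ofReal ((abs_sub _ _).trans (add_le_add (hv.2 s) (hw.2 s)))
  have hcontr : ContractingWith α.toNNReal (hmaps.restrict T' W W) := by
    refine ⟨Real.toNNReal_lt_one.2 hα1, fun ⟨v, hv⟩ ⟨w, hw⟩ => UniformFun.edist_le.2 fun s => ?_⟩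
    have hε : ∀ s, |toFun v s - toFun w s| ≤ (edist v w).toReal := fun s => by
      rw [← Real.dist_eq, dist_edist]
      exact ENNReal.toReal_mono (hfin v hv w hw) UniformFun.edist_eval_le
    calc edist (T (toFun v) s) (T (toFun w) s)
        = ENNReal.ofReal |T (toFun v) s - T (toFun w) s| := by rw [edist_dist, Real.dist_eq]
      _ ≤ ENNReal.ofReal (α * (edist v w).toReal) :=
        ENNReal.ofReal_le_ofReal (hdist _ _ _ hv.1 hv.2 hw.1 hw.2 hε s)
      _ = ENNReal.ofReal α * edist v w := by
        rw [ENNReal.ofReal_mul hα0, ENNReal.ofReal_toReal (hfin v hv w hw)]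
  have hzero : ofFun (fun _ => 0) ∈ W :=
    ⟨measurable_const, fun _ => abs_zero.trans_le hD⟩
  obtain ⟨v, hv, hfix, -⟩ := ContractingWith.exists_fixedPoint' (isComplete_measurable_abs_le D)
    hmaps hcontr hzero (hfin _ hzero _ (hmaps hzero))
  exact ⟨toFun v, hv.1, hv.2, hfix⟩

end FixedPoint

namespace ControlModel

variable {X Z : Type*} [MeasurableSpace X] [MeasurableSpace Z] {M : ControlModel X Z}

section Law

lemma Policy.map_state_kernel (π : M.Policy) (t : ℕ) :
    (π.kernel t).map M.state = Kernel.deterministic Prod.snd measurable_snd := by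
  have := π.isMarkov t
  ext1 ⟨h, x⟩
  rw [Kernel.map_apply _ M.measurable_state, Kernel.deterministic_apply,
    Measure.map_congr (g := fun _ => x) (π.feasible t h x)]
  simp

lemma Policy.map_state_init (π : M.Policy) : π.init.map M.state = Kernel.id := by
  ext1 x
  rw [Kernel.map_apply _ M.measurable_state, Policy.init, Kernel.comap_apply,
    ← Kernel.map_apply _ M.measurable_state, π.map_state_kernel, Kernel.deterministic_apply,
    Kernel.id_apply]

lemma Policy.map_state_step (π : M.Policy) (t : ℕ) :
    (π.step t).map M.state =
      M.trans.comap (fun h : (i : Finset.Iic t) → Z => h ⟨t, Finset.mem_Iic.2 le_rfl⟩)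
        (by fun_prop) := by
  have := M.isMarkov_trans
  rw [Policy.step, Kernel.map_comp, π.map_state_kernel, Kernel.deterministic_comp_eq_map,
    ← Kernel.snd_eq, Kernel.snd_prod]

instance (π : M.Policy) : IsMarkovKernel π.init := by
  have := π.isMarkov 0
  unfold Policy.init
  infer_instance

variable (π : M.Policy) (μ : Measure X)

instance [IsProbabilityMeasure μ] : IsProbabilityMeasure (π.law μ) := by
  unfold Policy.law
  infer_instance

lemma Policy.hasLaw_zero : HasLaw (fun ω : ℕ → Z => ω 0) (π.init ∘ₘ μ) (π.law μ) where
  aemeasurable := (measurable_pi_apply 0).aemeasurable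
  map_eq := by
    have hzero : (fun ω : ℕ → Z => ω 0) =
        MeasurableEquiv.piUnique (fun _ : Finset.Iic 0 => Z) ∘
          Preorder.frestrictLe (π := fun _ : ℕ => Z) 0 := rfl
    rw [hzero, ← Measure.map_map (by fun_prop) (by fun_prop), Policy.law, Kernel.trajMeasure,
      Measure.map_comp _ _ (by fun_prop), Kernel.traj_map_frestrictLe, Kernel.partialTraj_self,
      Measure.id_comp, Measure.map_map (by fun_prop) (by fun_prop),
      MeasurableEquiv.self_comp_symm, Measure.map_id]

lemma Policy.hasLaw_state_zero : HasLaw (fun ω : ℕ → Z => M.state (ω 0)) μ (π.law μ) :=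
  HasLaw.fun_comp
    ⟨M.measurable_state.aemeasurable, by
      rw [Measure.map_comp _ _ M.measurable_state, π.map_state_init, Measure.id_comp]⟩
    (π.hasLaw_zero μ)

variable [IsProbabilityMeasure μ]

lemma Policy.hasLaw_succ (t : ℕ) : HasLaw (fun ω : ℕ → Z => ω (t + 1))
    (π.step t ∘ₘ (π.law μ).map (Preorder.frestrictLe (π := fun _ : ℕ => Z) t)) (π.law μ) where
  aemeasurable := (measurable_pi_apply (t + 1)).aemeasurable
  map_eq := by
    have h := congrArg Measure.snd
      (Kernel.map_frestrictLe_trajMeasure_compProd_eq_map_trajMeasure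
        (X := fun _ => Z) (μ₀ := π.init ∘ₘ μ) (κ := π.step) (a := t))
    rw [Measure.snd_compProd, Measure.snd, Measure.map_map (by fun_prop) (by fun_prop)] at h
    exact h.symm

lemma Policy.hasLaw_state_succ (t : ℕ) : HasLaw (fun ω : ℕ → Z => M.state (ω (t + 1)))
    (M.trans ∘ₘ (π.law μ).map fun ω => ω t) (π.law μ) := by
  refine HasLaw.fun_comp ⟨M.measurable_state.aemeasurable, ?_⟩ (π.hasLaw_succ μ t)
  rw [Measure.map_comp _ _ M.measurable_state, π.map_state_step,
    ← Kernel.comp_deterministic_eq_comap, ← Measure.comp_assoc,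
    Measure.deterministic_comp_eq_map, Measure.map_map (by fun_prop) (by fun_prop)]
  rfl

lemma Policy.ae_law {p : Z → Prop} (hp : MeasurableSet {z | p z})
    (h : ∀ t a, ∀ᵐ z ∂(π.kernel t a), p z) (t : ℕ) : ∀ᵐ ω ∂(π.law μ), p (ω t) := by
  cases t with
  | zero =>
    rw [(π.hasLaw_zero μ).ae_iff (measurableSet_setOfPred.1 hp), Measure.ae_comp_iff hp]
    exact .of_forall fun x => h 0 _
  | succ t =>
    rw [(π.hasLaw_succ μ t).ae_iff (measurableSet_setOfPred.1 hp), Policy.step,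
      ← Measure.comp_assoc, Measure.ae_comp_iff hp]
    exact .of_forall fun x => h (t + 1) x

end Law

section Optimality

variable {α C D ε : ℝ} {v w : X → ℝ}

/-- The state-action value of the pair `z` when the states are worth `v` at the next stage: the
right-hand side of the optimality equation, before the maximization over the actions. -/
noncomputable def actionValue (M : ControlModel X Z) (α : ℝ) (v : X → ℝ) (z : Z) : ℝ :=
  M.reward z + α * ∫ x, v x ∂(M.trans z)

/-- The advantage of the pair `z` over the function `w`: how much `w` would have to grow at the
state of `z` for `z` to satisfy the optimality equation. -/
noncomputable def advantage (M : ControlModel X Z) (α : ℝ) (w : X → ℝ) (z : Z) : ℝ :=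
  M.actionValue α w z - w (M.state z)

/-- The optimality operator of dynamic programming. As the supremum is real-valued, it is only
meaningful when there are feasible pairs over every state and their values are bounded above. -/
noncomputable def bellmanOperator (M : ControlModel X Z) (α : ℝ) (v : X → ℝ) (x : X) : ℝ :=
  ⨆ z : M.state ⁻¹' {x}, M.actionValue α v z

lemma measurable_integral_trans (M : ControlModel X Z) (hv : Measurable v) :
    Measurable fun z => ∫ x, v x ∂(M.trans z) :=
  have := M.isMarkov_trans
  hv.stronglyMeasurable.integral_kernel.measurable

lemma measurable_actionValue (α : ℝ) (hv : Measurable v) : Measurable (M.actionValue α v) :=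
  M.measurable_reward.add ((M.measurable_integral_trans hv).const_mul α)

lemma measurable_advantage (α : ℝ) (hw : Measurable w) : Measurable (M.advantage α w) :=
  (measurable_actionValue α hw).sub (hw.comp M.measurable_state)

lemma abs_integral_trans_le (M : ControlModel X Z) (hD : ∀ x, |v x| ≤ D) (z : Z) :
    |∫ x, v x ∂(M.trans z)| ≤ D :=
  have := M.isMarkov_trans
  abs_integral_le_of_abs_le hD

lemma abs_actionValue_le (hα : 0 ≤ α) (hC : ∀ z, |M.reward z| ≤ C) (hD : ∀ x, |v x| ≤ D) (z : Z) :
    |M.actionValue α v z| ≤ C + α * D :=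
  calc |M.actionValue α v z| ≤ |M.reward z| + |α * ∫ x, v x ∂(M.trans z)| := abs_add_le _ _
    _ = |M.reward z| + α * |∫ x, v x ∂(M.trans z)| := by rw [abs_mul, abs_of_nonneg hα]
    _ ≤ C + α * D :=
      add_le_add (hC z) (mul_le_mul_of_nonneg_left (M.abs_integral_trans_le hD z) hα)

lemma abs_actionValue_sub_le (hα : 0 ≤ α) (hv : Measurable v) (hvD : ∀ x, |v x| ≤ D)
    (hw : Measurable w) (hwD : ∀ x, |w x| ≤ D) (hε : ∀ x, |v x - w x| ≤ ε) (z : Z) :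
    |M.actionValue α v z - M.actionValue α w z| ≤ α * ε := by
  have := M.isMarkov_trans
  calc |M.actionValue α v z - M.actionValue α w z|
      = |α * ∫ x, (v x - w x) ∂(M.trans z)| := by
        rw [integral_sub (integrable_of_abs_le hv hvD) (integrable_of_abs_le hw hwD), mul_sub,
          actionValue, actionValue, add_sub_add_left_eq_sub]
    _ = α * |∫ x, (v x - w x) ∂(M.trans z)| := by rw [abs_mul, abs_of_nonneg hα]
    _ ≤ α * ε := mul_le_mul_of_nonneg_left (M.abs_integral_trans_le hε z) hα

lemma bddAbove_actionValue (hα : 0 ≤ α) (hC : ∀ z, |M.reward z| ≤ C) (hD : ∀ x, |v x| ≤ D)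
    (A : Set Z) : BddAbove (Set.range fun z : A => M.actionValue α v z) :=
  ⟨C + α * D, Set.forall_mem_range.2 fun z => (abs_le.1 (abs_actionValue_le hα hC hD z)).2⟩

lemma actionValue_le_bellmanOperator (hα : 0 ≤ α) (hC : ∀ z, |M.reward z| ≤ C)
    (hD : ∀ x, |v x| ≤ D) (z : Z) : M.actionValue α v z ≤ M.bellmanOperator α v (M.state z) :=
  le_ciSup (bddAbove_actionValue hα hC hD (M.state ⁻¹' {M.state z})) ⟨z, rfl⟩

lemma abs_bellmanOperator_le (hM : M.state.Surjective) (hα : 0 ≤ α) (hC : ∀ z, |M.reward z| ≤ C)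
    (hD : ∀ x, |v x| ≤ D) (x : X) : |M.bellmanOperator α v x| ≤ C + α * D := by
  obtain ⟨z, rfl⟩ := hM x
  have : Nonempty (M.state ⁻¹' {M.state z}) := ⟨⟨z, rfl⟩⟩
  have hbound := fun z => abs_le.1 (abs_actionValue_le (M := M) hα hC hD z)
  exact abs_le.2 ⟨(hbound z).1.trans (actionValue_le_bellmanOperator hα hC hD z),
    ciSup_le fun z => (hbound z).2⟩

lemma abs_bellmanOperator_sub_le (hM : M.state.Surjective) (hα : 0 ≤ α)
    (hC : ∀ z, |M.reward z| ≤ C) (hv : Measurable v) (hvD : ∀ x, |v x| ≤ D) (hw : Measurable w)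
    (hwD : ∀ x, |w x| ≤ D) (hε : ∀ x, |v x - w x| ≤ ε) (x : X) :
    |M.bellmanOperator α v x - M.bellmanOperator α w x| ≤ α * ε :=
  have : Nonempty (M.state ⁻¹' {x}) := ⟨(hM x).choose, (hM x).choose_spec⟩
  abs_ciSup_sub_ciSup_le (bddAbove_actionValue hα hC hvD _) (bddAbove_actionValue hα hC hwD _)
    fun z => abs_actionValue_sub_le hα hv hvD hw hwD hε z.1

lemma exists_bellmanOperator_eq (hM : M.state.Surjective) (hα0 : 0 ≤ α) (hα1 : α < 1)
    (hC : ∀ z, |M.reward z| ≤ C)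
    (hmeas : ∀ v : X → ℝ, Measurable v → (∃ D, ∀ x, |v x| ≤ D) →
      Measurable (M.bellmanOperator α v)) :
    ∃ v D, Measurable v ∧ (∀ x, |v x| ≤ D) ∧ M.bellmanOperator α v = v := by
  have hα : 0 < 1 - α := sub_pos.2 hα1
  have hD : |C| + α * (|C| / (1 - α)) = |C| / (1 - α) := by
    field_simp
    ring
  obtain ⟨v, hv⟩ := exists_measurable_fixedPoint (T := M.bellmanOperator α) hα0 hα1
    (D := |C| / (1 - α)) (by positivity)
    (fun v hv hvD => ⟨hmeas v hv ⟨_, hvD⟩, fun x =>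
      (abs_bellmanOperator_le hM hα0 (fun z => (hC z).trans (le_abs_self C)) hvD x).trans_eq hD⟩)
    fun v w ε hv hvD hw hwD hε => abs_bellmanOperator_sub_le hM hα0 hC hv hvD hw hwD hε
  exact ⟨v, _, hv⟩

section Performance

variable (π : M.Policy) (μ : Measure X) [IsProbabilityMeasure μ]

lemma Policy.integral_state_succ (hw : Measurable w) (hD : ∀ x, |w x| ≤ D) (t : ℕ) :
    ∫ ω, w (M.state (ω (t + 1))) ∂(π.law μ) = ∫ ω, ∫ x, w x ∂(M.trans (ω t)) ∂(π.law μ) := by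
  have := M.isMarkov_trans
  have : IsProbabilityMeasure ((π.law μ).map fun ω => ω t) :=
    Measure.isProbabilityMeasure_map (measurable_pi_apply t).aemeasurable
  calc ∫ ω, w (M.state (ω (t + 1))) ∂(π.law μ)
      = ∫ x, w x ∂(M.trans ∘ₘ (π.law μ).map fun ω => ω t) :=
        (π.hasLaw_state_succ μ t).integral_comp hw.aestronglyMeasurable
    _ = ∫ z, ∫ x, w x ∂(M.trans z) ∂((π.law μ).map fun ω => ω t) :=
        integral_comp_measure (integrable_of_abs_le hw hD)
    _ = ∫ ω, ∫ x, w x ∂(M.trans (ω t)) ∂(π.law μ) :=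
        integral_map (measurable_pi_apply t).aemeasurable
          (M.measurable_integral_trans hw).aestronglyMeasurable

lemma Policy.integral_advantage (hC : ∀ z, |M.reward z| ≤ C) (hw : Measurable w)
    (hD : ∀ x, |w x| ≤ D) (t : ℕ) :
    ∫ ω, M.advantage α w (ω t) ∂(π.law μ) = ∫ ω, M.reward (ω t) ∂(π.law μ) +
      (α * ∫ ω, w (M.state (ω (t + 1))) ∂(π.law μ) - ∫ ω, w (M.state (ω t)) ∂(π.law μ)) := by
  have hreward : Integrable (fun ω : ℕ → Z => M.reward (ω t)) (π.law μ) :=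
    integrable_of_abs_le (M.measurable_reward.comp (measurable_pi_apply t)) fun _ => hC _
  have htrans : Integrable (fun ω : ℕ → Z => α * ∫ x, w x ∂(M.trans (ω t))) (π.law μ) :=
    (integrable_of_abs_le ((M.measurable_integral_trans hw).comp (measurable_pi_apply t))
      fun _ => M.abs_integral_trans_le hD _).const_mul α
  have hstate : Integrable (fun ω : ℕ → Z => w (M.state (ω t))) (π.law μ) :=
    integrable_of_abs_le (hw.comp (M.measurable_state.comp (measurable_pi_apply t))) fun _ => hD _
  calc ∫ ω, M.advantage α w (ω t) ∂(π.law μ)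
      = ∫ ω, (M.reward (ω t) + α * ∫ x, w x ∂(M.trans (ω t))) ∂(π.law μ) -
          ∫ ω, w (M.state (ω t)) ∂(π.law μ) := integral_sub (hreward.add htrans) hstate
    _ = _ := by
      rw [integral_add hreward htrans, integral_const_mul, π.integral_state_succ μ hw hD,
        add_sub_assoc]

/-- The performance difference formula, with `w` in the place of the value of a second policy. -/
lemma Policy.hasSum_integral_advantage (hα : |α| < 1) (hC : ∀ z, |M.reward z| ≤ C)
    (hw : Measurable w) (hD : ∀ x, |w x| ≤ D) :
    HasSum (fun t => α ^ t * ∫ ω, M.advantage α w (ω t) ∂(π.law μ))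
      (∫ ω, M.discountedReturn α ω ∂(π.law μ) - ∫ x, w x ∂μ) := by
  have hreward := hasSum_pow_mul_integral (μ := π.law μ) (f := fun t ω => M.reward (ω t)) hα
    (fun t => M.measurable_reward.comp (measurable_pi_apply t)) fun _ _ => hC _
  have hstate := hasSum_pow_mul_discounted_sub
    (a := fun t => ∫ ω, w (M.state (ω t)) ∂(π.law μ)) hα
    fun _ => abs_integral_le_of_abs_le fun _ => hD _
  have hinit : ∫ ω, w (M.state (ω 0)) ∂(π.law μ) = ∫ x, w x ∂μ :=
    (π.hasLaw_state_zero μ).integral_comp hw.aestronglyMeasurable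
  simp only [π.integral_advantage μ hC hw hD, mul_add]
  simpa only [hinit, ← sub_eq_add_neg, discountedReturn] using hreward.add hstate

end Performance

lemma Policy.hasSum_value_sub (π : M.Policy) (hα : |α| < 1) (hC : ∀ z, |M.reward z| ≤ C)
    (hw : Measurable w) (hD : ∀ x, |w x| ≤ D) (x : X) :
    HasSum (fun t => α ^ t * ∫ ω, M.advantage α w (ω t) ∂(π.law (Measure.dirac x)))
      (π.value α x - w x) := by
  simpa only [integral_dirac' _ _ hw.stronglyMeasurable, Policy.value] using
    π.hasSum_integral_advantage (Measure.dirac x) hα hC hw hD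

lemma Policy.value_le_of_advantage_nonpos (π : M.Policy) (hα0 : 0 ≤ α) (hα1 : α < 1)
    (hC : ∀ z, |M.reward z| ≤ C) (hw : Measurable w) (hD : ∀ x, |w x| ≤ D)
    (hle : ∀ z, M.advantage α w z ≤ 0) (x : X) :
    π.value α x ≤ w x :=
  sub_nonpos.1 <| (π.hasSum_value_sub ((abs_of_nonneg hα0).trans_lt hα1) hC hw hD x).nonpos
    fun t => mul_nonpos_of_nonneg_of_nonpos (pow_nonneg hα0 t) (integral_nonpos fun _ => hle _)

lemma Policy.value_eq_of_advantage_eq_zero (π : M.Policy) (hα : |α| < 1)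
    (hC : ∀ z, |M.reward z| ≤ C) (hw : Measurable w) (hD : ∀ x, |w x| ≤ D)
    (heq : ∀ t a, ∀ᵐ z ∂(π.kernel t a), M.advantage α w z = 0) (x : X) :
    π.value α x = w x := by
  have hzero : ∀ t, ∫ ω, M.advantage α w (ω t) ∂(π.law (Measure.dirac x)) = 0 := fun t =>
    integral_eq_zero_of_ae
      (π.ae_law _ (measurable_advantage α hw (measurableSet_singleton 0)) heq t)
  have hsum := π.hasSum_value_sub hα hC hw hD x
  simp only [hzero, mul_zero] at hsum
  exact sub_eq_zero.1 (hsum.unique hasSum_zero)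

end Optimality

end ControlModel

section Maximizers

variable {U : Type*}

/-- The set of the maximizers of `G` in `A`. -/
def maximizers (A : Set U) (G : U → ℝ) : Set U := {u ∈ A | IsMaxOn G A u}

/-- The lexicographic maximizers of the first `n` terms of the sequence `f` in `A`, used to single
out one point of `A`. -/
def lexMaximizers (A : Set U) (f : ℕ → U → ℝ) : ℕ → Set U
  | 0 => A
  | n + 1 => maximizers (lexMaximizers A f n) (f n)

lemma apply_eq_of_mem_lexMaximizers {A : Set U} {f : ℕ → U → ℝ} {u v : U}
    (hu : ∀ n, u ∈ lexMaximizers A f n) (hv : ∀ n, v ∈ lexMaximizers A f n) (n : ℕ) :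
    f n u = f n v :=
  le_antisymm ((hv (n + 1)).2 (hu n)) ((hu (n + 1)).2 (hv n))

variable [TopologicalSpace U] {A F : Set U} {G : U → ℝ} {f : ℕ → U → ℝ}

lemma nonempty_maximizers (hA : IsCompact A) (hne : A.Nonempty) (hG : UpperSemicontinuousOn G A) :
    (maximizers A G).Nonempty :=
  hG.exists_isMaxOn hne hA

lemma isCompact_maximizers (hA : IsCompact A) (hG : UpperSemicontinuousOn G A) :
    IsCompact (maximizers A G) := by
  rcases (maximizers A G).eq_empty_or_nonempty with hempty | ⟨u, hu, hmax⟩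
  · exact hempty ▸ isCompact_empty
  · have hlevel : maximizers A G = A ∩ G ⁻¹' Set.Ici (G u) := by
      ext v
      exact ⟨fun hv => ⟨hv.1, hv.2 hu⟩,
        fun hv => ⟨hv.1, fun w hw => (show G w ≤ G u from hmax hw).trans hv.2⟩⟩
    exact hlevel ▸ hG.isCompact_inter_preimage_Ici hA _

/-- Maximizers are characterized here by countably many conditions, none of which involves the
maximum itself. -/
lemma maximizers_inter_nonempty_iff (hA : IsCompact A) (hne : A.Nonempty)
    (hG : UpperSemicontinuousOn G A) (hF : IsClosed F) :
    (maximizers A G ∩ F).Nonempty ↔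
      ∀ q : ℚ, (∃ u ∈ A, (q : ℝ) ≤ G u) → ∃ u ∈ A ∩ F, (q : ℝ) ≤ G u := by
  refine ⟨fun ⟨u, hu, huF⟩ q ⟨v, hv, hq⟩ => ⟨u, ⟨hu.1, huF⟩, hq.trans (hu.2 hv)⟩, fun h => ?_⟩
  obtain ⟨u, hu, hmax⟩ := nonempty_maximizers hA hne hG
  have hneF : (A ∩ F).Nonempty := by
    obtain ⟨q, hq⟩ := exists_rat_lt (G u)
    obtain ⟨v, hv, -⟩ := h q ⟨u, hu, hq.le⟩
    exact ⟨v, hv⟩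
  obtain ⟨v, hv, hmaxF⟩ :=
    nonempty_maximizers (hA.inter_right hF) hneF (hG.mono Set.inter_subset_left)
  have hle : G u ≤ G v := by
    by_contra! hlt
    obtain ⟨q, hvq, hqu⟩ := exists_rat_btwn hlt
    obtain ⟨w, hw, hqw⟩ := h q ⟨u, hu, hqu.le⟩
    exact absurd (hmaxF hw) (not_le.2 (hvq.trans_le hqw))
  exact ⟨v, ⟨hv.1, fun w hw => (hmax hw).trans hle⟩, hv.2⟩

lemma isCompact_lexMaximizers (hA : IsCompact A) (hf : ∀ n, Continuous (f n)) (n : ℕ) :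
    IsCompact (lexMaximizers A f n) := by
  induction n with
  | zero => exact hA
  | succ n ih => exact isCompact_maximizers ih ((hf n).upperSemicontinuous.upperSemicontinuousOn _)

lemma exists_mem_forall_mem_lexMaximizers [T2Space U] (hA : IsCompact A)
    (hf : ∀ n, Continuous (f n)) (hF : IsClosed F)
    (hne : ∀ n, (lexMaximizers A f n ∩ F).Nonempty) :
    ∃ u ∈ F, ∀ n, u ∈ lexMaximizers A f n := by
  have hcompact : ∀ n, IsCompact (lexMaximizers A f n ∩ F) := fun n =>
    (isCompact_lexMaximizers hA hf n).inter_right hF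
  obtain ⟨u, hu⟩ := IsCompact.nonempty_iInter_of_sequence_nonempty_isCompact_isClosed
    (fun n => lexMaximizers A f n ∩ F)
    (fun n => Set.inter_subset_inter_left _ (Set.sep_subset _ _)) hne (hcompact 0)
    fun n => (hcompact n).isClosed
  rw [Set.mem_iInter] at hu
  exact ⟨u, (hu 0).2, fun n => (hu n).1⟩

end Maximizers

section MeasurableSelection

variable {S U : Type*} [MeasurableSpace S] [TopologicalSpace U] {A : S → Set U}

/-- A measurable correspondence with nonempty compact values. Measurability is that of the weak
inverse images of the closed sets. -/
structure IsMeasurableCompactValued (A : S → Set U) : Prop where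
  isCompact : ∀ s, IsCompact (A s)
  nonempty : ∀ s, (A s).Nonempty
  measurableSet_inter : ∀ F, IsClosed F → MeasurableSet {s | (A s ∩ F).Nonempty}

lemma IsMeasurableCompactValued.maximizers (hA : IsMeasurableCompactValued A) {G : S → U → ℝ}
    (hG : ∀ s, UpperSemicontinuousOn (G s) (A s))
    (hmeas : ∀ c F, IsClosed F → MeasurableSet {s | ∃ u ∈ A s ∩ F, c ≤ G s u}) :
    IsMeasurableCompactValued fun s => maximizers (A s) (G s) where
  isCompact s := isCompact_maximizers (hA.isCompact s) (hG s)
  nonempty s := nonempty_maximizers (hA.isCompact s) (hA.nonempty s) (hG s)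
  measurableSet_inter F hF := by
    simp only [fun s => maximizers_inter_nonempty_iff (hA.isCompact s) (hA.nonempty s) (hG s) hF]
    exact measurableSet_setOfPred.2 <| .forall fun q => .imp
      (measurableSet_setOfPred.1 (by simpa using hmeas q _ isClosed_univ))
      (measurableSet_setOfPred.1 (hmeas q F hF))

lemma IsMeasurableCompactValued.lexMaximizers (hA : IsMeasurableCompactValued A)
    {f : ℕ → U → ℝ} (hf : ∀ n, Continuous (f n)) (n : ℕ) :
    IsMeasurableCompactValued fun s => lexMaximizers (A s) f n := by
  induction n with
  | zero => exact hA
  | succ n ih =>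
    refine ih.maximizers (fun s => (hf n).upperSemicontinuous.upperSemicontinuousOn _)
      fun c F hF => ?_
    simpa only [Set.Nonempty, Set.mem_inter_iff, Set.mem_preimage, Set.mem_Ici, and_assoc] using
      ih.measurableSet_inter (F ∩ f n ⁻¹' Set.Ici c) (hF.inter (isClosed_Ici.preimage (hf n)))

/-- The selection is the lexicographic maximizer of a sequence of continuous functions that
separates points. -/
lemma IsMeasurableCompactValued.exists_measurable_selection
    [TopologicalSpace.MetrizableSpace U] [SecondCountableTopology U] [MeasurableSpace U]
    [BorelSpace U] (hA : IsMeasurableCompactValued A) :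
    ∃ g : S → U, Measurable g ∧ ∀ s, g s ∈ A s := by
  obtain ⟨e, he⟩ := TopologicalSpace.exists_embedding_l_infty U
  let f : ℕ → U → ℝ := fun n u => e u n
  have hf : ∀ n, Continuous (f n) := fun n =>
    (continuous_eval_const n).comp he.continuous
  have hsep : ∀ u v, (∀ n, f n u = f n v) → u = v := fun u v h =>
    he.injective (BoundedContinuousFunction.ext h)
  have hlex := hA.lexMaximizers hf
  have hexists : ∀ s, ∃ u, ∀ n, u ∈ _root_.lexMaximizers (A s) f n := fun s => by
    obtain ⟨u, -, hu⟩ := exists_mem_forall_mem_lexMaximizers (hA.isCompact s) hf isClosed_univ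
      fun n => by simpa using (hlex n).nonempty s
    exact ⟨u, hu⟩
  choose g hg using hexists
  refine ⟨g, measurable_of_isClosed fun F hF => ?_, fun s => hg s 0⟩
  have hpreimage : g ⁻¹' F = ⋂ n, {s | (_root_.lexMaximizers (A s) f n ∩ F).Nonempty} := by
    ext s
    rw [Set.mem_iInter]
    refine ⟨fun h n => ⟨g s, hg s n, h⟩, fun h => ?_⟩
    obtain ⟨u, huF, hu⟩ := exists_mem_forall_mem_lexMaximizers (hA.isCompact s) hf hF h
    rwa [hsep u (g s) (apply_eq_of_mem_lexMaximizers hu (hg s))] at huF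
  exact hpreimage ▸ .iInter fun n => (hlex n).measurableSet_inter F hF

end MeasurableSelection

section MaximumTheorem

variable {S U : Type*} [TopologicalSpace S] [SequentialSpace S] [T2Space S] [TopologicalSpace U]
  {K : Set (S × U)} {G : S × U → ℝ}

lemma isClosed_exists_le (hG : UpperSemicontinuousOn G K)
    (hK : ∀ C : Set S, IsCompact C → IsCompact {k : S × U | k ∈ K ∧ k.1 ∈ C}) (c : ℝ)
    {F : Set U} (hF : IsClosed F) :
    IsClosed {s | ∃ u ∈ {u | (s, u) ∈ K} ∩ F, c ≤ G (s, u)} := by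
  refine IsSeqClosed.isClosed fun x s hx hs => ?_
  have hcompact : IsCompact ({k : S × U | k ∈ K ∧ k.1 ∈ insert s (Set.range x)} ∩
      G ⁻¹' Set.Ici c ∩ Prod.snd ⁻¹' F) :=
    ((hG.mono fun k hk => hk.1).isCompact_inter_preimage_Ici
      (hK _ hs.isCompact_insert_range) c).inter_right (hF.preimage continuous_snd)
  obtain ⟨⟨s', u⟩, ⟨⟨⟨hu, -⟩, huc⟩, huF⟩, rfl⟩ :=
    (hcompact.image continuous_fst).isClosed.mem_of_tendsto hs <| .of_forall fun n => by
      obtain ⟨u, ⟨hu, huF⟩, huc⟩ := hx n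
      exact ⟨(x n, u), ⟨⟨⟨hu, Or.inr ⟨n, rfl⟩⟩, huc⟩, huF⟩, rfl⟩
  exact ⟨u, ⟨hu, huF⟩, huc⟩

lemma exists_measurable_maximizer [MeasurableSpace S] [OpensMeasurableSpace S]
    [TopologicalSpace.MetrizableSpace U] [SecondCountableTopology U] [MeasurableSpace U]
    [BorelSpace U] (hne : ∀ s, ∃ u, (s, u) ∈ K) (hG : UpperSemicontinuousOn G K)
    (hK : ∀ C : Set S, IsCompact C → IsCompact {k : S × U | k ∈ K ∧ k.1 ∈ C}) :
    ∃ g : S → U, Measurable g ∧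
      ∀ s, g s ∈ maximizers {u | (s, u) ∈ K} fun u => G (s, u) := by
  have hsections : IsMeasurableCompactValued fun s => {u | (s, u) ∈ K} := by
    refine ⟨fun s => ?_, hne, fun F hF => ?_⟩
    · convert (hK {s} isCompact_singleton).image continuous_snd
      ext u
      simp
    · have hconst : UpperSemicontinuousOn (fun _ : S × U => (0 : ℝ)) K :=
        continuousOn_const.upperSemicontinuousOn
      simpa [Set.Nonempty] using (isClosed_exists_le hconst hK 0 hF).measurableSet
  refine (hsections.maximizers (G := fun s u => G (s, u)) (fun s => ?_)
    fun c F hF => (isClosed_exists_le hG hK c hF).measurableSet).exists_measurable_selection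
  exact hG.comp (g := fun u => (s, u)) (by fun_prop) fun u hu => hu

end MaximumTheorem

namespace MarkovDecisionModel

variable {S U : Type*} [MeasurableSpace S] [MeasurableSpace U] {M : MarkovDecisionModel S U}

section Selector

/-- A measurable choice of a feasible action at every state, that is, a deterministic decision
rule. -/
structure Selector (M : MarkovDecisionModel S U) where
  action : S → U
  measurable_action : Measurable action
  mem_K : ∀ s, (s, action s) ∈ M.K

/-- The feasible state-action pair over the state `s` that is chosen by the selector `f`. -/
def Selector.pair (f : M.Selector) (s : S) : M.K := ⟨(s, f.action s), f.mem_K s⟩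

lemma Selector.measurable_pair (f : M.Selector) : Measurable f.pair :=
  (measurable_id.prodMk f.measurable_action).subtype_mk

lemma Selector.pairKernel_deterministic (f : M.Selector) {A : Type*} [MeasurableSpace A]
    {σ : A → S} (hσ : Measurable σ) :
    M.pairKernel σ hσ (Kernel.deterministic (f.action ∘ σ) (f.measurable_action.comp hσ)) =
      Kernel.deterministic (f.pair ∘ σ) (f.measurable_pair.comp hσ) := by
  have hcoe := MeasurableEmbedding.subtype_coe M.measurableSet_K
  ext1 a
  have hpair : (σ a, f.action (σ a)) = (f.pair (σ a) : S × U) := rfl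
  rw [pairKernel, Kernel.deterministic_prod_deterministic, Kernel.comapRight_apply,
    Kernel.deterministic_apply, Kernel.deterministic_apply, Function.comp_apply, hpair,
    ← Measure.map_dirac' hcoe.measurable, hcoe.comap_map, Function.comp_apply]

/-- The stationary deterministic policy that follows the selector `f`. -/
noncomputable def Selector.policy (f : M.Selector) : M.Policy where
  kernel _ := Kernel.deterministic (f.action ∘ Prod.snd) (f.measurable_action.comp measurable_snd)
  isMarkov _ := inferInstance
  feasible _ _ s := Measure.dirac_apply_of_mem (f.mem_K s)

lemma Selector.kernel_toControlPolicy_policy [MeasurableSingletonClass S] (f : M.Selector)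
    (t : ℕ) : f.policy.toControlPolicy.kernel t =
      Kernel.deterministic (f.pair ∘ Prod.snd) (f.measurable_pair.comp measurable_snd) :=
  f.pairKernel_deterministic measurable_snd

/-- The selector `f` as a randomized decision rule. -/
noncomputable def Selector.rule (f : M.Selector) : M.DecisionRule where
  kernel := Kernel.deterministic f.action f.measurable_action
  isMarkov := inferInstance
  feasible s := Measure.dirac_apply_of_mem (f.mem_K s)

lemma Selector.joint_eq_map (f : M.Selector) (ν : ProbabilityMeasure S) :
    ((⟨ν, f.rule⟩ : M.LiftedPair).joint : Measure M.K) = (ν : Measure S).map f.pair := by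
  change M.pairKernel id measurable_id
    (Kernel.deterministic (f.action ∘ id) f.measurable_action) ∘ₘ (ν : Measure S) = _
  rw [f.pairKernel_deterministic, Measure.deterministic_comp_eq_map]
  rfl

end Selector

section OptimalityEquation

variable {α C : ℝ} {v : S → ℝ}

lemma surjective_state (M : MarkovDecisionModel S U) : M.toControlModel.state.Surjective :=
  fun s => (M.nonempty_K s).elim fun u hu => ⟨⟨(s, u), hu⟩, rfl⟩

variable [TopologicalSpace S] [SequentialSpace S] [T2Space S] [OpensMeasurableSpace S]
  [TopologicalSpace U] [TopologicalSpace.MetrizableSpace U] [SecondCountableTopology U]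
  [BorelSpace U]

lemma exists_selector_isMaxOn {G : M.K → ℝ} (hG : UpperSemicontinuous G)
    (hcomp : M.CompactOverCompact) :
    ∃ f : M.Selector, ∀ s, ∀ k : M.K, k.1.1 = s → G k ≤ G (f.pair s) := by
  let G' : S × U → ℝ := Function.extend Subtype.val G 0
  have hG' : ∀ k : M.K, G' k = G k := Subtype.val_injective.extend_apply G 0
  have husc : UpperSemicontinuousOn G' M.K :=
    upperSemicontinuousOn_iff_restrict.1 ((funext hG' : M.K.domRestrict G' = G) ▸ hG)
  obtain ⟨g, hg, hmax⟩ := exists_measurable_maximizer M.nonempty_K husc hcomp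
  refine ⟨⟨g, hg, fun s => (hmax s).1⟩, ?_⟩
  rintro _ k rfl
  rw [← hG', ← hG']
  exact (hmax k.1.1).2 k.2

lemma exists_selector_bellmanOperator_eq (hr : UpperSemicontinuous M.r)
    (hQ : M.StronglyContinuous) (hcomp : M.CompactOverCompact) (hv : Measurable v)
    (hbdd : ∃ D, ∀ s, |v s| ≤ D) :
    ∃ f : M.Selector, ∀ s,
      M.toControlModel.bellmanOperator α v s = M.toControlModel.actionValue α v (f.pair s) := by
  have husc : UpperSemicontinuous (M.toControlModel.actionValue α v) :=
    hr.add (continuous_const.mul (hQ v hv hbdd)).upperSemicontinuous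
  obtain ⟨f, hf⟩ := exists_selector_isMaxOn husc hcomp
  refine ⟨f, fun s => IsGreatest.csSup_eq ⟨⟨⟨f.pair s, rfl⟩, rfl⟩, ?_⟩⟩
  rintro _ ⟨k, rfl⟩
  exact hf s k k.2

lemma exists_optimality_solution (hα0 : 0 ≤ α) (hα1 : α < 1) (hr : UpperSemicontinuous M.r)
    (hC : ∀ k, |M.r k| ≤ C) (hQ : M.StronglyContinuous) (hcomp : M.CompactOverCompact) :
    ∃ (v : S → ℝ) (D : ℝ) (f : M.Selector), Measurable v ∧ (∀ s, |v s| ≤ D) ∧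
      (∀ k, M.toControlModel.advantage α v k ≤ 0) ∧
      ∀ s, M.toControlModel.advantage α v (f.pair s) = 0 := by
  obtain ⟨v, D, hv, hD, hfix⟩ := M.toControlModel.exists_bellmanOperator_eq M.surjective_state
    hα0 hα1 hC fun v hv hbdd => by
      obtain ⟨f, hf⟩ := exists_selector_bellmanOperator_eq (α := α) hr hQ hcomp hv hbdd
      exact (funext hf : M.toControlModel.bellmanOperator α v = _) ▸
        (ControlModel.measurable_actionValue α hv).comp f.measurable_pair
  obtain ⟨f, hf⟩ := exists_selector_bellmanOperator_eq (α := α) hr hQ hcomp hv ⟨D, hD⟩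
  refine ⟨v, D, f, hv, hD, fun k => sub_nonpos.2 ?_, fun s => sub_eq_zero.2 ?_⟩
  · calc M.toControlModel.actionValue α v k
        ≤ M.toControlModel.bellmanOperator α v k.1.1 :=
          ControlModel.actionValue_le_bellmanOperator hα0 hC hD k
      _ = v k.1.1 := congrFun hfix _
  · exact (hf s).symm.trans (congrFun hfix s)

end OptimalityEquation

section Lift

lemma LiftedPair.measurable_mk (φ : M.DecisionRule) :
    Measurable fun ν : ProbabilityMeasure S => (⟨ν, φ⟩ : M.LiftedPair) :=
  have hjoint : Measurable fun ν : ProbabilityMeasure S =>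
      M.pairKernel id measurable_id φ.kernel ∘ₘ (ν : Measure S) :=
    (Measure.measurable_bind' (Kernel.measurable _)).comp measurable_subtype_coe
  measurable_comap_iff.2 hjoint.subtype_mk

/-- The policy of the measurized model that uses the decision rule `φ` at all times. -/
noncomputable def liftedPolicy [MeasurableSpace.CountablyGenerated S] (φ : M.DecisionRule) :
    M.measurized.Policy where
  kernel _ := Kernel.deterministic (fun a => ⟨a.2, φ⟩)
    ((LiftedPair.measurable_mk φ).comp measurable_snd)
  isMarkov _ := inferInstance
  feasible _ h ν := by
    have := measurableSingletonClass_probabilityMeasure (S := S)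
    rw [Kernel.deterministic_apply]
    exact (ae_dirac_iff (LiftedPair.measurable_dist (measurableSet_singleton ν))).2 rfl

variable {α C D : ℝ} {v : S → ℝ}

lemma advantage_measurized_eq_integral (hC : ∀ k, |M.r k| ≤ C) (hv : Measurable v)
    (hD : ∀ s, |v s| ≤ D) (p : M.LiftedPair) :
    M.measurized.advantage α (fun ν => ∫ s, v s ∂(ν : Measure S)) p =
      ∫ k, M.toControlModel.advantage α v k ∂(p.joint : Measure M.K) := by
  have := M.isMarkov_Q
  have hstate : Measurable fun k : M.K => k.1.1 := by fun_prop
  have hreward : Integrable M.r (p.joint : Measure M.K) := integrable_of_abs_le M.measurable_r hC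
  have htrans : Integrable (fun k => α * ∫ s, v s ∂(M.Q k)) (p.joint : Measure M.K) :=
    (integrable_of_abs_le (M.toControlModel.measurable_integral_trans hv)
      (M.toControlModel.abs_integral_trans_le hD)).const_mul α
  have hnext : ∫ ν, (∫ s, v s ∂(ν : Measure S)) ∂(M.measurized.trans p) =
      ∫ k, ∫ s, v s ∂(M.Q k) ∂(p.joint : Measure M.K) :=
    (Kernel.integral_deterministic' LiftedPair.measurable_next
      (measurable_integral_probabilityMeasure hv).stronglyMeasurable).trans
      (integral_comp_measure (integrable_of_abs_le hv hD))
  have hdist : ∫ s, v s ∂(p.dist : Measure S) = ∫ k, v k.1.1 ∂(p.joint : Measure M.K) := by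
    rw [← p.map_joint, integral_map hstate.aemeasurable hv.aestronglyMeasurable]
  calc M.measurized.advantage α (fun ν => ∫ s, v s ∂(ν : Measure S)) p
      = ∫ k, M.r k ∂(p.joint : Measure M.K) +
          α * ∫ k, ∫ s, v s ∂(M.Q k) ∂(p.joint : Measure M.K) -
          ∫ k, v k.1.1 ∂(p.joint : Measure M.K) := by rw [← hnext, ← hdist]; rfl
    _ = ∫ k, (M.r k + α * ∫ s, v s ∂(M.Q k)) ∂(p.joint : Measure M.K) -
          ∫ k, v k.1.1 ∂(p.joint : Measure M.K) := by
        rw [integral_add hreward htrans, integral_const_mul]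
    _ = ∫ k, M.toControlModel.advantage α v k ∂(p.joint : Measure M.K) :=
        (integral_sub (hreward.add htrans)
          (integrable_of_abs_le (hv.comp hstate) fun _ => hD _)).symm

end Lift

section OptimalValue

variable {α C D : ℝ} {v : S → ℝ} {f : M.Selector}

lemma optimalValue_eq_of_advantage [MeasurableSingletonClass S] (hα0 : 0 ≤ α) (hα1 : α < 1)
    (hC : ∀ k, |M.r k| ≤ C) (hv : Measurable v) (hD : ∀ s, |v s| ≤ D)
    (hle : ∀ k, M.toControlModel.advantage α v k ≤ 0)
    (heq : ∀ s, M.toControlModel.advantage α v (f.pair s) = 0) (s : S) :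
    M.optimalValue α s = v s := by
  have hzero : MeasurableSet {k | M.toControlModel.advantage α v k = 0} :=
    ControlModel.measurable_advantage α hv (measurableSet_singleton 0)
  refine IsGreatest.csSup_eq ⟨⟨f.policy, ?_⟩, ?_⟩
  · refine f.policy.toControlPolicy.value_eq_of_advantage_eq_zero ((abs_of_nonneg hα0).trans_lt hα1)
      hC hv hD (fun t a => ?_) s
    rw [f.kernel_toControlPolicy_policy, Kernel.deterministic_apply, ae_dirac_iff hzero]
    exact heq a.2
  · rintro _ ⟨π, rfl⟩
    exact π.toControlPolicy.value_le_of_advantage_nonpos hα0 hα1 hC hv hD hle s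

lemma measurizedOptimalValue_eq_integral_of_advantage [MeasurableSpace.CountablyGenerated S]
    (hα0 : 0 ≤ α) (hα1 : α < 1) (hC : ∀ k, |M.r k| ≤ C) (hv : Measurable v) (hD : ∀ s, |v s| ≤ D)
    (hle : ∀ k, M.toControlModel.advantage α v k ≤ 0)
    (heq : ∀ s, M.toControlModel.advantage α v (f.pair s) = 0) (ν : ProbabilityMeasure S) :
    M.measurizedOptimalValue α ν = ∫ s, v s ∂(ν : Measure S) := by
  have hw := measurable_integral_probabilityMeasure hv
  have hwD : ∀ ν : ProbabilityMeasure S, |∫ s, v s ∂(ν : Measure S)| ≤ D := fun ν =>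
    abs_integral_le_of_abs_le hD
  have hreward : ∀ p, |M.measurized.reward p| ≤ C := fun p => abs_integral_le_of_abs_le hC
  refine IsGreatest.csSup_eq ⟨⟨liftedPolicy f.rule, ?_⟩, ?_⟩
  · refine (liftedPolicy f.rule).value_eq_of_advantage_eq_zero ((abs_of_nonneg hα0).trans_lt hα1)
      hreward hw hwD (fun t a => ?_) ν
    refine (ae_dirac_iff (ControlModel.measurable_advantage α hw (measurableSet_singleton 0))).2 ?_
    rw [advantage_measurized_eq_integral hC hv hD, f.joint_eq_map,
      integral_map f.measurable_pair.aemeasurable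
        (ControlModel.measurable_advantage α hv).aestronglyMeasurable]
    simp only [heq, integral_zero, Set.mem_singleton_iff]
  · rintro _ ⟨π, rfl⟩
    refine π.value_le_of_advantage_nonpos hα0 hα1 hreward hw hwD (fun p => ?_) ν
    rw [advantage_measurized_eq_integral hC hv hD]
    exact integral_nonpos hle

end OptimalValue

end MarkovDecisionModel

lemma ae_tendsto_average_of_pairwise_indepFun {Ω S : Type*} [MeasurableSpace Ω]
    [MeasurableSpace S] {P : Measure Ω} {μ : Measure S} {X : ℕ → Ω → S} {h : S → ℝ}
    (hlaw : ∀ n, HasLaw (X n) μ P) (hindep : Pairwise fun i j => IndepFun (X i) (X j) P)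
    (hh : Measurable h) (hint : Integrable h μ) :
    ∀ᵐ ω ∂P, Filter.Tendsto
      (fun N : ℕ => (1 / (N : ℝ)) * ∑ n ∈ Finset.range N, h (X n ω))
      Filter.atTop (nhds (∫ s, h s ∂μ)) := by
  have hslln := strong_law_ae_real (fun n ω => h (X n ω))
    ((hlaw 0).map_eq ▸ hint |>.comp_aemeasurable (hlaw 0).aemeasurable)
    (fun i j hij => (hindep hij).comp hh hh) fun n => ((hlaw n).identDistrib (hlaw 0)).comp hh
  have hmean : ∫ ω, h (X 0 ω) ∂P = ∫ s, h s ∂μ :=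
    (hlaw 0).integral_comp hh.aestronglyMeasurable
  rw [hmean] at hslln
  simpa only [div_eq_inv_mul, mul_one] using hslln

theorem corollary5p1_general
    {S U : Type*} [TopologicalSpace S] [SequentialSpace S] [T2Space S]
    [MeasurableSpace S] [OpensMeasurableSpace S] [MeasurableSpace.CountablyGenerated S]
    [TopologicalSpace U] [TopologicalSpace.MetrizableSpace U] [SecondCountableTopology U]
    [MeasurableSpace U] [BorelSpace U]
    (M : MarkovDecisionModel S U) (α : ℝ) (hα0 : 0 ≤ α) (hα1 : α < 1)
    (hr : UpperSemicontinuous M.r) (hbdd : Bornology.IsBounded (Set.range M.r))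
    (hQ : M.StronglyContinuous) (hcomp : M.CompactOverCompact) (ν : ProbabilityMeasure S)
    {Ω : Type*} [MeasurableSpace Ω] (P : Measure Ω)
    (X : ℕ → Ω → S) (hlaw : ∀ n, HasLaw (X n) (ν : Measure S) P)
    (hindep : Pairwise fun i j => IndepFun (X i) (X j) P) :
    ∀ᵐ ω ∂P, Filter.Tendsto
      (fun N : ℕ => (1 / (N : ℝ)) * ∑ n ∈ Finset.range N, M.optimalValue α (X n ω))
      Filter.atTop (nhds (M.measurizedOptimalValue α ν)) := by
  obtain ⟨C, hC⟩ : ∃ C, ∀ k, |M.r k| ≤ C := by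
    simpa only [Set.forall_mem_range, Real.norm_eq_abs] using hbdd.exists_norm_le
  obtain ⟨v, D, f, hv, hD, hle, heq⟩ :=
    MarkovDecisionModel.exists_optimality_solution hα0 hα1 hr hC hQ hcomp
  rw [MarkovDecisionModel.measurizedOptimalValue_eq_integral_of_advantage hα0 hα1 hC hv hD hle heq]
  simp only [MarkovDecisionModel.optimalValue_eq_of_advantage hα0 hα1 hC hv hD hle heq]
  exact ae_tendsto_average_of_pairwise_indepFun hlaw hindep hv (integrable_of_abs_le hv hD)

theorem corollary5p1
    {S U : Type*}
    [TopologicalSpace S] [TopologicalSpace.MetrizableSpace S] [SecondCountableTopology S]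
    [MeasurableSpace S] [BorelSpace S] [StandardBorelSpace S]
    [TopologicalSpace U] [TopologicalSpace.MetrizableSpace U] [SecondCountableTopology U]
    [MeasurableSpace U] [BorelSpace U] [StandardBorelSpace U]
    (M : MarkovDecisionModel S U) (α : ℝ) (hα0 : 0 ≤ α) (hα1 : α < 1)
    (hr : M.RewardRegular) (hQ : M.StronglyContinuous) (hfin : M.HasFinitePolicy α)
    (hbelow : BddBelow (Set.range M.r)) (hcomp : M.CompactOverCompact)
    (ν : ProbabilityMeasure S)
    {Ω : Type*} [MeasurableSpace Ω] (P : Measure Ω) [IsProbabilityMeasure P]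
    (X : ℕ → Ω → S) (hlaw : ∀ n, HasLaw (X n) (ν : Measure S) P) (hindep : iIndepFun X P) :
    ∀ᵐ ω ∂P, Filter.Tendsto
      (fun N : ℕ => (1 / (N : ℝ)) * ∑ n ∈ Finset.range N, M.optimalValue α (X n ω))
      Filter.atTop (nhds (M.measurizedOptimalValue α ν)) :=
  corollary5p1_general M α hα0 hα1 hr.upperSemicontinuous
    (isBounded_iff_bddBelow_bddAbove.2 ⟨hbelow, hr.bddAbove⟩) hQ hcomp ν P X hlaw
    fun _ _ hij => hindep.indepFun hij
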